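/- Let $(X,d)$ be a complete geodesic metric space and let $n\ge 4$ be an integer. Then $X$ satisfies the $n$-point condition if and only if $X$ is a CAT(0) space. Here a geodesic segment $[x,y]$ in $X$ is (the image of) a path from $x$ to $y$ of length $d(x,y)$, and $X$ is geodesic if any two of its points are joined by at least one geodesic segment. $X$ is a CAT(0) space if it is geodesic and, for all $x,y,z\in X$, all choices of geodesic segments $[x,y]$, $[y,z]$, $[z,x]$, all $\bar x,\bar y,\bar z$ in the Euclidean plane $\mathbb R^2$ with $|\bar x-\bar y|=d(x,y)$, $|\bar y-\bar z|=d(y,z)$, $|\bar z-\bar x|=d(z,x)$, and all $u\in[x,y]$ and $v\in[z,x]$, one has $d(u,v)\le|\bar u-\bar v|$, where $\bar u\in[\bar x,\bar y]$ and $\bar v\in[\bar x,\bar z]$ are the points with $|\bar x-\bar u|=d(x,u)$ and $|\bar x-\bar v|=d(x,v)$. $X$ satisfies the $n$-point condition if for every $n$-tuple $(x_1,\dots,x_n)$ of (not necessarily distinct) points of $X$ there are points $\bar x_1,\dots,\bar x_n\in\mathbb R^2$ such that, with $x_0:=x_n$ and $\bar x_0:=\bar x_n$, $$d(x_i,x_{i-1})=|\bar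 x_i-\bar x_{i-1}|\quad(1\le i\le n),\qquad d(x_i,x_j)\le|\bar x_i-\bar x_j|\quad(1\le i,j\le n).$$ -/

import Mathlib

/-- The plane `ℝ²` with the Euclidean metric. -/
abbrev EuclPlane : Type := EuclideanSpace ℝ (Fin 2)

/-- `S` is (the image of) a geodesic segment `[x, y]` in `X`: a path `γ : [0, L] → X`, `L ≥ 0`, from
`x` to `y` whose length is the distance between its endpoints. Only the values of `γ` on `[0, L]`
are used. -/
def IsGeodesicSegment {X : Type*} [MetricSpace X] (S : Set X) (x y : X) : Prop :=
  ∃ (L : ℝ) (γ : ℝ → X), 0 ≤ L ∧ ContinuousOn γ (Set.Icc 0 L) ∧ γ 0 = x ∧ γ L = y ∧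
    eVariationOn γ (Set.Icc 0 L) = ENNReal.ofReal (dist x y) ∧ γ '' Set.Icc 0 L = S

/-- A geodesic space: any two points are joined by at least one geodesic segment. -/
def IsGeodesicSpace (X : Type*) [MetricSpace X] : Prop :=
  ∀ x y : X, ∃ S : Set X, IsGeodesicSegment S x y

/-- A geodesic triangle with vertices `x, y, z` and sides `[x, y]`, `[y, z]`, `[z, x]`. -/
structure IsGeodesicTriangle {X : Type*} [MetricSpace X] (x y z : X) (Sxy Syz Szx : Set X) :
    Prop where
  side_xy : IsGeodesicSegment Sxy x y
  side_yz : IsGeodesicSegment Syz y z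
  side_zx : IsGeodesicSegment Szx z x

/-- `x', y', z'` are the vertices of a Euclidean comparison triangle for `x, y, z`. -/
structure IsComparisonTriangle {X : Type*} [MetricSpace X] (x y z : X) (x' y' z' : EuclPlane) :
    Prop where
  dist_xy : dist x' y' = dist x y
  dist_yz : dist y' z' = dist y z
  dist_zx : dist z' x' = dist z x

/-- `u'` is the comparison point on the Euclidean segment `[x', y']` for a point `u` of a geodesic
segment joining `x` and `y`: the point of `[x', y']` at distance `d(x, u)` from `x'`. -/
def IsComparisonPoint {X : Type*} [MetricSpace X] (x u : X) (x' y' u' : EuclPlane) : Prop :=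
  u' ∈ segment ℝ x' y' ∧ dist x' u' = dist x u

/-- A CAT(0) space. -/
def IsCAT0 (X : Type*) [MetricSpace X] : Prop :=
  IsGeodesicSpace X ∧
    ∀ (x y z : X) (Sxy Syz Szx : Set X), IsGeodesicTriangle x y z Sxy Syz Szx →
    ∀ x' y' z' : EuclPlane, IsComparisonTriangle x y z x' y' z' →
    ∀ u ∈ Sxy, ∀ v ∈ Szx, ∀ u' v' : EuclPlane,
      IsComparisonPoint x u x' y' u' → IsComparisonPoint x v x' z' v' →
      dist u v ≤ dist u' v'

/-- `(x' 1, …, x' n)` is a `C`-rough subembedding of `(x 1, …, x n)` into the plane. The tuples are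
given as sequences, of which only the entries with index `0, …, n` matter, closed up by
`x 0 = x n` and `x' 0 = x' n`. -/
structure IsRoughSubembedding {X : Type*} [MetricSpace X] (C : ℝ) (n : ℕ) (x : ℕ → X)
    (x' : ℕ → EuclPlane) : Prop where
  closed : x 0 = x n
  closed' : x' 0 = x' n
  dist_side : ∀ i, 1 ≤ i → i ≤ n → dist (x i) (x (i - 1)) = dist (x' i) (x' (i - 1))
  dist_first : ∀ i, 2 ≤ i → i ≤ n → dist (x 1) (x i) ≤ dist (x' 1) (x' i)
  dist_diag : ∀ i j, 2 ≤ i → i ≤ n → 2 ≤ j → j ≤ n →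
    dist (x i) (x j) ≤ dist (x' i) (x' j) + C

/-- The `C`-rough `n`-point condition: every `n`-tuple `(x 1, …, x n)` in `X` (with `x 0 := x n`) has
a `C`-rough subembedding into the plane. -/
def RoughPointCondition (X : Type*) [MetricSpace X] (C : ℝ) (n : ℕ) : Prop :=
  ∀ x : ℕ → X, x 0 = x n → ∃ x' : ℕ → EuclPlane, IsRoughSubembedding C n x x'

/-- The (exact) `n`-point condition is the `0`-rough `n`-point condition. -/
def PointCondition (X : Type*) [MetricSpace X] (n : ℕ) : Prop :=
  RoughPointCondition X 0 n

/-! Both conditions are equivalent to the weighted Bruhat–Tits inequality, which is an equality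
(Stewart's theorem, `dist_lineMap_sq`) in Euclidean space.

From the point condition: apply it to `x, m, y, z` with `m` on a geodesic from `x` to `y`. The
planar image of `m` is forced onto the segment between the images of `x` and `y`, so Stewart's
theorem bounds `d(z, m)` (`PointCondition.isCNPoint`). Two uses of the inequality give the CAT(0)
comparison (`isCAT0_of_isCNPoint`).

From CAT(0): a closed polygon has a convex planar majorant, in the spirit of Reshetnyak, by
induction on the number of vertices (`IsCNSpace.exists_isMajorant`). Attach to the closing side of a
majorant the comparison triangle of the new vertex. If the result is still convex, it is the new
majorant (`IsMajorant.extend`). Otherwise an end of that side becomes a reflex vertex. Regard the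
old polygon and the triangle as lying in two planes glued along the side. There the reflex vertex
lies on a geodesic between its neighbours, so it may be dropped; the shorter polygon has a majorant
by induction, and the vertex is put back on a side of it (`IsMajorant.exists_of_reflex`). The
induction closes up because the glued planes again satisfy the inequality
(`SegmentDouble.isCNSpace`), which is proved by unfolding across the segment (`exists_unfold`). -/

/-! ### The weighted Bruhat–Tits inequality -/

/-- `m` divides `x, y` in the ratio `t : 1 - t` and satisfies the weighted inequality of Bruhat and
Tits with respect to every point of the space. -/
def IsCNPoint {X : Type*} [PseudoMetricSpace X] (x y m : X) (t : ℝ) : Prop :=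
  ∀ z, dist z m ^ 2 ≤ (1 - t) * dist z x ^ 2 + t * dist z y ^ 2 - t * (1 - t) * dist x y ^ 2

/-- A pseudometric space in which the weighted Bruhat–Tits inequality holds. -/
def IsCNSpace (X : Type*) [PseudoMetricSpace X] : Prop :=
  ∀ (x y : X) (t : ℝ), 0 ≤ t → t ≤ 1 → ∃ m, IsCNPoint x y m t

section CNPoint

variable {X : Type*} [PseudoMetricSpace X] {x y m w : X} {s t : ℝ}

theorem IsCNPoint.symm (h : IsCNPoint x y m t) : IsCNPoint y x m (1 - t) := by
  intro z
  have := h z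
  rw [dist_comm y x]
  linarith

theorem IsCNPoint.dist_left_le (h : IsCNPoint x y m t) (ht : 0 ≤ t) :
    dist x m ≤ t * dist x y := by
  have := h x
  rw [dist_self] at this
  exact abs_le_of_sq_le_sq' (by linarith) (by positivity) |>.2

/-- Substituting one inequality into the other is lossless: the coefficients of `dist x y ^ 2` add
up to `t * s * (1 - t * s)`. -/
theorem IsCNPoint.comp (hw : IsCNPoint x y w s) (hd : dist x w = s * dist x y)
    (hm : IsCNPoint x w m t) (ht : 0 ≤ t) : IsCNPoint x y m (t * s) := by
  intro z
  have h1 := hm z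
  have h2 := mul_le_mul_of_nonneg_left (hw z) ht
  rw [hd] at h1
  linarith

/-- Division points are unique up to distance zero: at `z = m` the right side of the inequality for
`m'` vanishes. -/
theorem IsCNSpace.isCNPoint_of_dist_eq (hX : IsCNSpace X) (h0 : 0 ≤ t) (h1 : t ≤ 1)
    (hl : dist x m = t * dist x y) (hr : dist m y = (1 - t) * dist x y) : IsCNPoint x y m t := by
  obtain ⟨m', hm'⟩ := hX x y t h0 h1
  have h2 := hm' m
  rw [dist_comm m x, hl, hr] at h2
  have h3 : dist m m' = 0 := by
    have : dist m m' ^ 2 ≤ 0 := by linarith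
    exact pow_eq_zero_iff two_ne_zero |>.1 (le_antisymm this (sq_nonneg _))
  intro z
  have : dist z m = dist z m' := by
    have h4 := dist_triangle z m m'
    have h5 := dist_triangle_right z m m'
    linarith
  rw [this]
  exact hm' z

theorem IsCNSpace.exists_isCNPoint_of_dist_add (hX : IsCNSpace X)
    (h : dist x m + dist m y = dist x y) :
    ∃ t, 0 ≤ t ∧ t ≤ 1 ∧ dist x m = t * dist x y ∧ dist m y = (1 - t) * dist x y ∧
      IsCNPoint x y m t := by
  obtain ⟨t, h0, h1, hl⟩ : ∃ t, 0 ≤ t ∧ t ≤ 1 ∧ dist x m = t * dist x y := by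
    rcases eq_or_lt_of_le (dist_nonneg (x := x) (y := y)) with h0 | h0
    · refine ⟨0, le_rfl, zero_le_one, ?_⟩
      have := dist_nonneg (x := x) (y := m)
      have := dist_nonneg (x := m) (y := y)
      linarith
    · refine ⟨dist x m / dist x y, by positivity, ?_, by field_simp⟩
      rw [div_le_one h0, ← h]
      linarith [dist_nonneg (x := m) (y := y)]
  have hr : dist m y = (1 - t) * dist x y := by linarith
  exact ⟨t, h0, h1, hl, hr, hX.isCNPoint_of_dist_eq h0 h1 hl hr⟩

end CNPoint

/-! ### Gluing two copies of an inner product space along a segment -/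

/-- Two copies of `E`, glued along the segment `[p, q]`. -/
def SegmentDouble {E : Type*} (_p _q : E) : Type _ := E ⊕ E

namespace SegmentDouble

variable {E : Type*} {p q : E}

/-- The first copy of `E`. -/
def left {E : Type*} (p q u : E) : SegmentDouble p q := Sum.inl u

/-- The second copy of `E`. -/
def right {E : Type*} (p q u : E) : SegmentDouble p q := Sum.inr u

theorem eq_left_or_right (z : SegmentDouble p q) : ∃ u, z = left p q u ∨ z = right p q u := by
  rcases z with u | u
  exacts [⟨u, Or.inl rfl⟩, ⟨u, Or.inr rfl⟩]

/-- The reflection exchanging the two copies. -/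
def swap : SegmentDouble p q → SegmentDouble p q := Sum.swap

theorem swap_left (u : E) : swap (left p q u) = right p q u := rfl

theorem swap_right (u : E) : swap (right p q u) = left p q u := rfl

theorem swap_swap (z : SegmentDouble p q) : swap (swap z) = z := Sum.swap_swap z

end SegmentDouble

section InnerProduct

variable {E : Type*} [NormedAddCommGroup E] [InnerProductSpace ℝ E]

theorem dist_lineMap_sq (z x y : E) (t : ℝ) :
    dist z (AffineMap.lineMap x y t) ^ 2 =
      (1 - t) * dist z x ^ 2 + t * dist z y ^ 2 - t * (1 - t) * dist x y ^ 2 := by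
  have h1 : z - AffineMap.lineMap x y t = (1 - t) • (z - x) + t • (z - y) := by
    rw [AffineMap.lineMap_apply_module]; module
  have h2 : x - y = (z - y) - (z - x) := by abel
  simp only [dist_eq_norm]
  rw [h1, h2, norm_add_sq_real, norm_sub_sq_real (z - y) (z - x), norm_smul, norm_smul, mul_pow, mul_pow,
    Real.norm_eq_abs, Real.norm_eq_abs, sq_abs, sq_abs, real_inner_smul_left,
    real_inner_smul_right, real_inner_comm (z - x)]
  ring

theorem isCNPoint_lineMap (x y : E) (t : ℝ) : IsCNPoint x y (AffineMap.lineMap x y t) t :=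
  fun z => (dist_lineMap_sq z x y t).le

theorem isCNSpace_innerProductSpace : IsCNSpace E :=
  fun x y t _ _ => ⟨_, isCNPoint_lineMap x y t⟩

/-- A quadratic upper bound that replaces the derivative of the norm; it is AM-GM for `‖a - τ • v‖`
and `‖a‖`. -/
theorem norm_sub_smul_le {a : E} (ha : a ≠ 0) (v : E) (τ : ℝ) :
    ‖a - τ • v‖ ≤ ‖a‖ - τ * (inner ℝ a v / ‖a‖) + τ ^ 2 * (‖v‖ ^ 2 / (2 * ‖a‖)) := by
  have hn : 0 < ‖a‖ := norm_pos_iff.2 ha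
  have h1 : ‖a - τ • v‖ ^ 2 = ‖a‖ ^ 2 - 2 * τ * inner ℝ a v + τ ^ 2 * ‖v‖ ^ 2 := by
    rw [@norm_sub_sq_real, norm_smul, mul_pow, Real.norm_eq_abs, sq_abs, real_inner_smul_right]
    ring
  have h2 : ‖a‖ - τ * (inner ℝ a v / ‖a‖) + τ ^ 2 * (‖v‖ ^ 2 / (2 * ‖a‖)) =
      (‖a - τ • v‖ ^ 2 + ‖a‖ ^ 2) / (2 * ‖a‖) := by
    rw [h1]; field_simp; ring
  rw [h2, le_div_iff₀ (by positivity)]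
  nlinarith [sq_nonneg (‖a - τ • v‖ - ‖a‖)]

/-- Unfolding a broken geodesic: if `w` minimizes `‖z - p‖ + ‖p - u‖` over the points `p` of a convex
set, then `z` can be moved to a point `z'` in line with `u` and `w` without increasing its distance
to any point of the convex set. -/
theorem exists_unfold {s : Set E} (hs : Convex ℝ s) {z u w : E} (hw : w ∈ s)
    (hmin : ∀ p ∈ s, dist z w + dist w u ≤ dist z p + dist p u) :
    ∃ z', dist z' u = dist z w + dist w u ∧ ∀ p ∈ s, dist z' p ≤ dist z p := by
  by_cases hu : u = w
  · subst hu
    exact ⟨z, by simp, fun p _ => le_rfl⟩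
  by_cases hz : z = w
  · subst hz
    exact ⟨z, by simp, fun p _ => le_rfl⟩
  set a := z - w with ha
  set c := u - w with hc
  have ha0 : a ≠ 0 := sub_ne_zero.2 hz
  have hc0 : c ≠ 0 := sub_ne_zero.2 hu
  have han : 0 < ‖a‖ := norm_pos_iff.2 ha0
  have hcn : 0 < ‖c‖ := norm_pos_iff.2 hc0
  -- First-order optimality of `w`: the sum of the unit vectors from `w` towards `z` and `u` makes
  -- no acute angle with a direction into `s`.
  have first : ∀ p ∈ s, inner ℝ a (p - w) / ‖a‖ + inner ℝ c (p - w) / ‖c‖ ≤ 0 := by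
    intro p hp
    set v := p - w with hv
    by_contra! hpos
    set S := inner ℝ a v / ‖a‖ + inner ℝ c v / ‖c‖ with hS
    set K := ‖v‖ ^ 2 / (2 * ‖a‖) + ‖v‖ ^ 2 / (2 * ‖c‖) with hK
    have hK0 : 0 ≤ K := by positivity
    have key : ∀ τ : ℝ, 0 ≤ τ → τ ≤ 1 → τ * S ≤ τ ^ 2 * K := by
      intro τ h0 h1
      have hq : w + τ • v ∈ s := by
        have := hs hw hp (sub_nonneg.2 h1) h0 (by ring)
        convert this using 1
        rw [hv]; module
      have h := hmin _ hq
      have e1 : dist z (w + τ • v) = ‖a - τ • v‖ := by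
        rw [dist_eq_norm, ha]; congr 1; abel
      have e2 : dist (w + τ • v) u = ‖c - τ • v‖ := by
        rw [dist_comm, dist_eq_norm, hc]; congr 1; abel
      have e3 : dist w u = ‖c‖ := by rw [dist_comm, dist_eq_norm]
      rw [e1, e2, e3, dist_eq_norm z w] at h
      have := norm_sub_smul_le ha0 v τ
      have := norm_sub_smul_le hc0 v τ
      rw [hS, hK]
      linarith
    -- At `τ = S / (S + K)` the bound `S ≤ τ * K` would give `S ^ 2 ≤ 0`.
    have hτ : S / (S + K) ≤ 1 := (div_le_one (by linarith)).2 (by linarith)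
    have hτ0 : 0 < S / (S + K) := div_pos hpos (by linarith)
    have h := key _ hτ0.le hτ
    rw [sq, mul_assoc] at h
    have h := le_of_mul_le_mul_left h hτ0
    rw [div_mul_eq_mul_div, le_div_iff₀ (by linarith)] at h
    nlinarith
  -- The point opposite to `u` beyond `w`, at distance `‖a‖` from `w`. The change in squared
  -- distance to `p` is `2 * ‖a‖` times the quantity in `first`.
  refine ⟨w - (‖a‖ / ‖c‖) • c, ?_, ?_⟩
  · have : w - (‖a‖ / ‖c‖) • c - u = -((‖a‖ / ‖c‖ + 1) • c) := by rw [hc]; module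
    rw [dist_eq_norm, this, norm_neg, norm_smul, Real.norm_eq_abs, abs_of_nonneg (by positivity),
      dist_comm w u, dist_eq_norm z w, dist_eq_norm u w, ← ha, ← hc]
    field_simp
  · intro p hp
    have h := first p hp
    set v := p - w with hv
    have e1 : w - (‖a‖ / ‖c‖) • c - p = -((‖a‖ / ‖c‖) • c + v) := by rw [hv]; abel
    have e2 : z - p = a - v := by rw [ha, hv]; abel
    rw [dist_eq_norm, dist_eq_norm, e1, e2, norm_neg]
    refine abs_le_of_sq_le_sq' ?_ (norm_nonneg _) |>.2
    rw [norm_add_sq_real, norm_sub_sq_real a v, norm_smul, Real.norm_eq_abs,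
      abs_of_nonneg (by positivity), real_inner_smul_left, div_mul_cancel₀ _ hcn.ne']
    have h' : ‖a‖ * (inner ℝ a v / ‖a‖ + inner ℝ c v / ‖c‖) ≤ 0 :=
      mul_nonpos_of_nonneg_of_nonpos han.le h
    have h2 : ‖a‖ * (inner ℝ a v / ‖a‖ + inner ℝ c v / ‖c‖) =
      inner ℝ a v + ‖a‖ / ‖c‖ * inner ℝ c v := by field_simp
    linarith

instance SegmentDouble.nonempty_segment (p q : E) :
    Nonempty (segment ℝ p q) := ⟨⟨p, left_mem_segment ℝ p q⟩⟩

/-- The two copies of a point of the segment are at distance zero but are not identified, whence the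
use of pseudometric spaces. -/
noncomputable instance (p q : E) : PseudoMetricSpace (SegmentDouble p q) :=
  Metric.gluePremetric (isometry_subtype_coe : Isometry (Subtype.val : segment ℝ p q → E))
    (isometry_subtype_coe : Isometry (Subtype.val : segment ℝ p q → E))

namespace SegmentDouble

variable {p q : E}

@[simp] theorem dist_left (u v : E) : dist (left p q u) (left p q v) = dist u v := rfl

@[simp] theorem dist_right (u v : E) : dist (right p q u) (right p q v) = dist u v := rfl

theorem dist_left_right_eq (u v : E) : dist (left p q u) (right p q v) =
    ⨅ w : segment ℝ p q, dist u w + dist v w := by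
  change (⨅ w : segment ℝ p q, dist u w + dist v w) + 0 = _
  rw [add_zero]

theorem dist_left_right_comm (u v : E) :
    dist (left p q u) (right p q v) = dist (left p q v) (right p q u) := by
  simp only [dist_left_right_eq, add_comm]

theorem dist_left_right_le (u v : E) {w : E} (hw : w ∈ segment ℝ p q) :
    dist (left p q u) (right p q v) ≤ dist u w + dist w v := by
  rw [dist_left_right_eq, dist_comm w v]
  exact ciInf_le (f := fun w : segment ℝ p q => dist u w + dist v w)
    ⟨0, Set.forall_mem_range.2 fun _ => by positivity⟩ ⟨w, hw⟩

theorem exists_dist_left_right_eq (u v : E) :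
    ∃ w ∈ segment ℝ p q, dist (left p q u) (right p q v) = dist u w + dist w v := by
  have hc : IsCompact (segment ℝ p q) := by
    rw [segment_eq_image_lineMap]
    exact isCompact_Icc.image (by fun_prop)
  obtain ⟨w, hw, hmin⟩ := hc.exists_isMinOn ⟨p, left_mem_segment ℝ p q⟩
    (f := fun w => dist u w + dist w v) (by fun_prop)
  refine ⟨w, hw, le_antisymm (dist_left_right_le u v hw) ?_⟩
  rw [dist_left_right_eq]
  refine le_ciInf fun x => ?_
  rw [dist_comm v]
  exact hmin x.2

theorem le_dist_left_right {u v : E} {r : ℝ}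
    (h : ∀ w ∈ segment ℝ p q, r ≤ dist u w + dist w v) : r ≤ dist (left p q u) (right p q v) := by
  obtain ⟨w, hw, e⟩ := exists_dist_left_right_eq (p := p) (q := q) u v
  rw [e]
  exact h w hw

theorem dist_left_right_of_mem {u : E} (hu : u ∈ segment ℝ p q) (v : E) :
    dist (left p q u) (right p q v) = dist u v := by
  refine le_antisymm (by simpa using dist_left_right_le u v hu)
    (le_dist_left_right fun w _ => dist_triangle u w v)

theorem dist_left_right_self {u : E} (hu : u ∈ segment ℝ p q) :
    dist (left p q u) (right p q u) = 0 := by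
  rw [dist_left_right_of_mem hu, dist_self]

/-- Reduces comparisons with a point of the second copy to `E`: a path to `v` through a point of the
segment becomes no longer when `v` is replaced by `v'`. -/
theorem exists_unfold_right (u v : E) : ∃ v', dist v' u = dist (left p q u) (right p q v) ∧
    (∀ w ∈ segment ℝ p q, dist v' w ≤ dist v w) ∧
    ∀ z, dist z v' ≤ dist (left p q z) (right p q v) := by
  obtain ⟨w, hw, e⟩ := exists_dist_left_right_eq (p := p) (q := q) u v
  obtain ⟨v', h1, h2⟩ := exists_unfold (convex_segment p q) (z := v) (u := u) hw (by
    intro x hx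
    have := dist_left_right_le u v hx
    rw [e] at this
    rw [dist_comm v w, dist_comm w u, dist_comm v x, dist_comm x u]
    linarith)
  refine ⟨v', ?_, h2, fun z => le_dist_left_right fun x hx => ?_⟩
  · rw [h1, e, dist_comm v w, dist_comm w u, add_comm]
  · have := dist_triangle z x v'
    have := h2 x hx
    rw [dist_comm v' x, dist_comm v x] at this
    linarith

theorem dist_swap (y z : SegmentDouble p q) : dist (swap y) (swap z) = dist y z := by
  obtain ⟨u, rfl | rfl⟩ := eq_left_or_right y <;> obtain ⟨v, rfl | rfl⟩ := eq_left_or_right z <;>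
    simp only [swap_left, swap_right, dist_left, dist_right]
  · rw [dist_comm, dist_left_right_comm]
  · rw [dist_comm _ (left p q v), dist_left_right_comm]

theorem isCNPoint_swap {x y m : SegmentDouble p q} {t : ℝ} (h : IsCNPoint x y m t) :
    IsCNPoint (swap x) (swap y) (swap m) t := by
  intro z
  have := h (swap z)
  rw [← swap_swap z]
  simpa only [dist_swap] using this

/-- A point of the second copy is unfolded as seen from the division point: that distance is kept,
those to `x` and `y` do not grow, and Stewart's theorem applies in `E`. -/
theorem isCNPoint_left (x y : E) (t : ℝ) (h0 : 0 ≤ t) (h1 : t ≤ 1) :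
    IsCNPoint (left p q x) (left p q y) (left p q (AffineMap.lineMap x y t)) t := by
  intro z
  obtain ⟨z, rfl | rfl⟩ := eq_left_or_right z
  · exact isCNPoint_lineMap x y t z
  · obtain ⟨z', e, -, h⟩ := exists_unfold_right (p := p) (q := q) (AffineMap.lineMap x y t) z
    have hx := h x
    have hy := h y
    rw [dist_comm _ (left p q _), ← e, dist_comm _ (left p q x), dist_comm _ (left p q y),
      dist_lineMap_sq, dist_left, dist_comm z' x, dist_comm z' y]
    have : (1 - t) * dist x z' ^ 2 ≤ (1 - t) * dist (left p q x) (right p q z) ^ 2 := by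
      have : 0 ≤ 1 - t := by linarith
      gcongr
    have : t * dist y z' ^ 2 ≤ t * dist (left p q y) (right p q z) ^ 2 := by gcongr
    linarith

theorem isCNPoint_right (x y : E) (t : ℝ) (h0 : 0 ≤ t) (h1 : t ≤ 1) :
    IsCNPoint (right p q x) (right p q y) (right p q (AffineMap.lineMap x y t)) t :=
  isCNPoint_swap (isCNPoint_left x y t h0 h1)

/-- The comparison with a point of the first copy, for a geodesic that passes from the first copy
to the second at the point `w`. -/
theorem dist_left_crossing_le {x y w : E} {t : ℝ} (h0 : 0 ≤ t) (h1 : t ≤ 1)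
    (hw : w ∈ segment ℝ p q)
    (hl : dist x w = t * dist (left p q x) (right p q y))
    (hr : dist w y = (1 - t) * dist (left p q x) (right p q y)) (z : E) :
    dist z w ^ 2 ≤ (1 - t) * dist z x ^ 2 + t * dist (left p q z) (right p q y) ^ 2
      - t * (1 - t) * dist (left p q x) (right p q y) ^ 2 := by
  obtain ⟨y', e, h, hz⟩ := exists_unfold_right (p := p) (q := q) x y
  have h2 := h w hw
  rw [dist_comm y' w, dist_comm y w] at h2
  rw [dist_comm y' x] at e
  -- Since `dist w y' ≤ dist w y`, the triangle inequality forces `w` to divide `x, y'` in the ratio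
  -- `t : 1 - t`.
  have h3 := dist_triangle x w y'
  have h4 := isCNSpace_innerProductSpace.isCNPoint_of_dist_eq (x := x) (y := y') (m := w) h0 h1
    (by rw [e]; exact hl) (by rw [e]; linarith) z
  have : t * dist z y' ^ 2 ≤ t * dist (left p q z) (right p q y) ^ 2 := by
    have := hz z
    gcongr
  rw [e] at h4
  linarith

theorem isCNPoint_crossing {x y w : E} {t : ℝ} (h0 : 0 ≤ t) (h1 : t ≤ 1)
    (hw : w ∈ segment ℝ p q)
    (hl : dist x w = t * dist (left p q x) (right p q y))
    (hr : dist w y = (1 - t) * dist (left p q x) (right p q y)) :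
    IsCNPoint (left p q x) (right p q y) (left p q w) t := by
  intro z
  obtain ⟨z, rfl | rfl⟩ := eq_left_or_right z
  · exact dist_left_crossing_le h0 h1 hw hl hr z
  · rw [dist_comm _ (left p q w), dist_left_right_of_mem hw, dist_comm _ (left p q x),
      dist_left_right_comm x z, dist_left_right_comm x y, dist_comm w z]
    have := dist_left_crossing_le (x := y) (y := x) (w := w) (t := 1 - t) (by linarith)
      (by linarith) hw (by rw [dist_comm, hr, dist_left_right_comm])
      (by rw [dist_comm, hl, dist_left_right_comm]; ring) z
    rw [dist_right]
    linarith

/-- A shortest path crosses the segment at some `w`, in the ratio `s : 1 - s`. The required point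
lies on the part before or after `w`, and `IsCNPoint.comp` applies to that part. -/
theorem exists_isCNPoint_left_right (x y : E) {t : ℝ} (h0 : 0 ≤ t) (h1 : t ≤ 1) :
    ∃ m, IsCNPoint (left p q x) (right p q y) m t := by
  set D := dist (left p q x) (right p q y) with hD
  obtain ⟨w, hw, e⟩ := exists_dist_left_right_eq (p := p) (q := q) x y
  rw [← hD] at e
  obtain ⟨s, hs0, hs1, hl⟩ : ∃ s, 0 ≤ s ∧ s ≤ 1 ∧ dist x w = s * D := by
    rcases eq_or_lt_of_le (dist_nonneg (x := left p q x) (y := right p q y)) with h | h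
    · refine ⟨0, le_rfl, zero_le_one, ?_⟩
      have := dist_nonneg (x := x) (y := w)
      have := dist_nonneg (x := w) (y := y)
      linarith
    · rw [← hD] at h
      refine ⟨dist x w / D, by positivity, ?_, by field_simp⟩
      rw [div_le_one h, e]
      linarith [dist_nonneg (x := w) (y := y)]
  have hr : dist w y = (1 - s) * D := by linarith
  have hcn := isCNPoint_crossing hs0 hs1 hw hl hr
  rcases le_total t s with hts | hts
  · obtain ⟨r, hr0, hr1, rfl⟩ : ∃ r, 0 ≤ r ∧ r ≤ 1 ∧ t = r * s := by
      rcases eq_or_lt_of_le hs0 with h | h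
      · exact ⟨0, le_rfl, zero_le_one, by linarith⟩
      · exact ⟨t / s, by positivity, (div_le_one h).2 hts, by field_simp⟩
    exact ⟨_, hcn.comp (by simpa using hl) (isCNPoint_left x w r hr0 hr1) hr0⟩
  · obtain ⟨r, hr0, hr1, e'⟩ : ∃ r, 0 ≤ r ∧ r ≤ 1 ∧ 1 - t = r * (1 - s) := by
      rcases eq_or_lt_of_le hs1 with h | h
      · exact ⟨0, le_rfl, zero_le_one, by linarith⟩
      · have : 0 < 1 - s := by linarith
        exact ⟨(1 - t) / (1 - s), div_nonneg (by linarith) this.le,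
          (div_le_one this).2 (by linarith), by field_simp⟩
    have hcn' : IsCNPoint (left p q x) (right p q y) (right p q w) s := by
      intro z
      have h1 := dist_triangle z (left p q w) (right p q w)
      rw [dist_left_right_self hw, add_zero] at h1
      exact (pow_le_pow_left₀ dist_nonneg h1 2).trans (hcn z)
    have := hcn'.symm.comp (t := r) (m := right p q (AffineMap.lineMap y w r))
      (by rw [dist_right, dist_comm y w, hr, dist_comm (right p q y)])
      (isCNPoint_right y w r hr0 hr1) hr0
    rw [← e'] at this
    exact ⟨_, by simpa using this.symm⟩

theorem isCNSpace (p q : E) : IsCNSpace (SegmentDouble p q) := by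
  intro x y t h0 h1
  obtain ⟨x, rfl | rfl⟩ := eq_left_or_right x <;> obtain ⟨y, rfl | rfl⟩ := eq_left_or_right y
  · exact ⟨_, isCNPoint_left x y t h0 h1⟩
  · exact exists_isCNPoint_left_right x y h0 h1
  · obtain ⟨m, hm⟩ := exists_isCNPoint_left_right (p := p) (q := q) y x (t := 1 - t)
      (by linarith) (by linarith)
    exact ⟨m, by simpa using hm.symm⟩
  · exact ⟨_, isCNPoint_right x y t h0 h1⟩

end SegmentDouble

end InnerProduct

/-! ### Planar majorants and the inductive step -/

/-- In the Euclidean triangle the inequality is an equality, and its right side increases with the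
two sides at `z'`. -/
theorem IsCNPoint.dist_le_dist_lineMap {X E : Type*} [PseudoMetricSpace X] [NormedAddCommGroup E]
    [InnerProductSpace ℝ E] {x y m z : X} {x' y' z' : E} {t : ℝ} (h : IsCNPoint x y m t)
    (h0 : 0 ≤ t) (h1 : t ≤ 1) (hxy : dist x' y' = dist x y) (hx : dist z x ≤ dist z' x')
    (hy : dist z y ≤ dist z' y') : dist z m ≤ dist z' (AffineMap.lineMap x' y' t) := by
  refine abs_le_of_sq_le_sq' ?_ dist_nonneg |>.2
  have := h z
  rw [dist_lineMap_sq, hxy]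
  have : (1 - t) * dist z x ^ 2 ≤ (1 - t) * dist z' x' ^ 2 := by
    have : 0 ≤ 1 - t := by linarith
    gcongr
  have : t * dist z y ^ 2 ≤ t * dist z' y' ^ 2 := by gcongr
  linarith

/-- A segment joining two sides of a triangle meets the cevians from their common vertex. -/
theorem segment_inter_cevian_nonempty {E : Type*} [AddCommGroup E] [Module ℝ E]
    {v a b c p q : E} (hp : p ∈ segment ℝ v a) (hq : q ∈ segment ℝ v b)
    (hc : c ∈ segment ℝ a b) : (segment ℝ v c ∩ segment ℝ p q).Nonempty := by
  obtain ⟨s', s, hs', hs, hss, rfl⟩ := hp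
  obtain ⟨t', t, ht', ht, htt, rfl⟩ := hq
  obtain ⟨l', l, hl', hl, hll, rfl⟩ := hc
  obtain rfl : s' = 1 - s := by linarith
  obtain rfl : t' = 1 - t := by linarith
  obtain rfl : l' = 1 - l := by linarith
  have hs0 := mul_nonneg hs hl
  have ht0 := mul_nonneg ht hl'
  rcases eq_or_lt_of_le (add_nonneg hs0 ht0) with h | h
  · have h1 : s * l = 0 := by linarith
    have h2 : t * (1 - l) = 0 := by linarith
    refine ⟨v, left_mem_segment ℝ _ _, ?_⟩
    rcases mul_eq_zero.1 h1 with rfl | rfl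
    · simpa using left_mem_segment ℝ v _
    · obtain rfl : t = 0 := by simpa using h2
      simpa using right_mem_segment ℝ _ v
  · set D := s * l + t * (1 - l) with hD
    have hst : s * t ≤ D := by nlinarith
    -- Weights proportional to `t * (1 - l)` on `p` and `s * l` on `q` put `a` and `b` in the ratio
    -- `1 - l : l`, as on the cevian.
    refine ⟨(1 - s * t / D) • v + (s * t / D) • ((1 - l) • a + l • b),
      ⟨_, _, sub_nonneg.2 ((div_le_one h).2 hst), by positivity, by ring, rfl⟩,
      t * (1 - l) / D, s * l / D, by positivity, by positivity, by field_simp; rw [hD]; ring, ?_⟩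
    match_scalars
    · field_simp; rw [hD]; ring
    · field_simp
    · field_simp

/-- The closed polygon `y 0, …, y k` in the plane, whose diagonals cross like those of a convex
polygon, has the same side lengths as the polygon `x 0, …, x k`, and its diagonals are at least as
long. -/
structure IsMajorant {X : Type*} [PseudoMetricSpace X] (k : ℕ) (x : ℕ → X) (y : ℕ → ℂ) :
    Prop where
  side : ∀ i < k, dist (y i) (y (i + 1)) = dist (x i) (x (i + 1))
  closing : dist (y 0) (y k) = dist (x 0) (x k)
  diag : ∀ i j, i ≤ k → j ≤ k → dist (x i) (x j) ≤ dist (y i) (y j)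
  cross : ∀ i j m l, i < j → j < m → m < l → l ≤ k →
    (segment ℝ (y i) (y m) ∩ segment ℝ (y j) (y l)).Nonempty

section Step

variable {X : Type*} [PseudoMetricSpace X] {k : ℕ} {x : ℕ → X} {y : ℕ → ℂ} {b : ℂ}

open SegmentDouble

/-- A path in the double crosses the common side at some `w`. The corresponding division point of `x
k, x 0` splits the distance in `X` into two parts, each bounded by its Euclidean counterpart. -/
theorem IsMajorant.dist_le_segmentDouble (hX : IsCNSpace X) (h : IsMajorant k x y)
    (hb0 : dist b (y 0) = dist (x (k + 1)) (x 0)) (hbk : dist b (y k) = dist (x (k + 1)) (x k))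
    {j : ℕ} (hj : j ≤ k) :
    dist (x j) (x (k + 1)) ≤ dist (left (y k) (y 0) (y j)) (right (y k) (y 0) b) := by
  refine le_dist_left_right fun w hw => ?_
  rw [segment_eq_image_lineMap] at hw
  obtain ⟨t, ⟨h0, h1⟩, rfl⟩ := hw
  obtain ⟨m, hm⟩ := hX (x k) (x 0) t h0 h1
  have hd : dist (y k) (y 0) = dist (x k) (x 0) := by rw [dist_comm, h.closing, dist_comm]
  have e1 := hm.dist_le_dist_lineMap h0 h1 hd (h.diag j k hj le_rfl) (h.diag j 0 hj (Nat.zero_le _))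
  have e2 := hm.dist_le_dist_lineMap h0 h1 hd hbk.ge hb0.ge
  rw [dist_comm _ b]
  have := dist_triangle_right (x j) (x (k + 1)) m
  linarith

/-- Inserting a vertex on the closing side preserves the crossing property. -/
theorem cross_insert {z w : ℕ → ℂ}
    (hz : ∀ i j m l, i < j → j < m → m < l → l ≤ k →
      (segment ℝ (z i) (z m) ∩ segment ℝ (z j) (z l)).Nonempty)
    (h0 : w 0 ∈ segment ℝ (z 0) (z k)) (hw : ∀ i, w (i + 1) = z i) :
    ∀ i j m l, i < j → j < m → m < l → l ≤ k + 1 →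
      (segment ℝ (w i) (w m) ∩ segment ℝ (w j) (w l)).Nonempty := by
  intro i j m l hij hjm hml hl
  obtain ⟨j, rfl⟩ := Nat.exists_eq_succ_of_ne_zero (by omega : j ≠ 0)
  obtain ⟨m, rfl⟩ := Nat.exists_eq_succ_of_ne_zero (by omega : m ≠ 0)
  obtain ⟨l, rfl⟩ := Nat.exists_eq_succ_of_ne_zero (by omega : l ≠ 0)
  simp only [Nat.succ_eq_add_one, hw] at hij hjm hml hl ⊢
  rcases Nat.eq_zero_or_pos i with rfl | hi
  -- The diagonal from the inserted vertex is a cevian of the triangle `z m, z 0, z k`, and `[z j, z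
  -- l]` meets both sides at `z m`.
  · obtain ⟨p, hp, hp'⟩ : (segment ℝ (z m) (z 0) ∩ segment ℝ (z j) (z l)).Nonempty := by
      rcases Nat.eq_zero_or_pos j with rfl | hj
      · exact ⟨z 0, right_mem_segment ℝ _ _, left_mem_segment ℝ _ _⟩
      · rw [segment_symm]
        exact hz 0 j m l hj (by omega) (by omega) (by omega)
    obtain ⟨q, hq, hq'⟩ : (segment ℝ (z m) (z k) ∩ segment ℝ (z j) (z l)).Nonempty := by
      rcases eq_or_lt_of_le (by omega : l ≤ k) with rfl | hl
      · exact ⟨z l, right_mem_segment ℝ _ _, right_mem_segment ℝ _ _⟩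
      · rw [Set.inter_comm]
        exact hz j m l k (by omega) (by omega) hl le_rfl
    rw [segment_symm]
    exact (segment_inter_cevian_nonempty hp hq h0).mono
      (Set.inter_subset_inter_right _ ((convex_segment _ _).segment_subset hp' hq'))
  · obtain ⟨i, rfl⟩ := Nat.exists_eq_succ_of_ne_zero (by omega : i ≠ 0)
    rw [Nat.succ_eq_add_one, hw]
    exact hz i j m l (by omega) (by omega) (by omega) (by omega)

/-- The inductive step when the new triangle makes the angle at `y 0` reflex. -/
theorem IsMajorant.exists_of_reflex (hX : IsCNSpace X) (hk : 1 ≤ k)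
    (hQ : ∀ (p q : ℂ) (x : ℕ → SegmentDouble p q), ∃ y, IsMajorant k x y)
    (h : IsMajorant k x y)
    (hb0 : dist b (y 0) = dist (x (k + 1)) (x 0)) (hbk : dist b (y k) = dist (x (k + 1)) (x k))
    (hvia : ∀ w ∈ segment ℝ (y k) (y 0),
      dist b (y 0) + dist (y 0) (y 1) ≤ dist b w + dist w (y 1)) :
    ∃ w, IsMajorant (k + 1) x w := by
  set Q := SegmentDouble (y k) (y 0)
  -- The polygon `y 1, …, y k, b` in the double. It omits `y 0`, so the hypothesis for `k` applies.
  let f : ℕ → Q := fun i => if i < k then left _ _ (y (i + 1)) else right _ _ b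
  have f1 : ∀ i < k, f i = left _ _ (y (i + 1)) := fun i hi => if_pos hi
  have f2 : f k = right _ _ b := if_neg (lt_irrefl _)
  obtain ⟨z, hz⟩ := hQ _ _ f
  have hy0 : y 0 ∈ segment ℝ (y k) (y 0) := right_mem_segment ℝ _ _
  have hyk : y k ∈ segment ℝ (y k) (y 0) := left_mem_segment ℝ _ _
  -- By `hvia`, a shortest path from `y 1` to `b` passes through `y 0`.
  have hd : dist (f 0) (f k) = dist (f 0) (left _ _ (y 0)) + dist (left _ _ (y 0)) (f k) := by
    refine le_antisymm (dist_triangle _ _ _) ?_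
    rw [f1 0 (by omega), f2, dist_left_right_of_mem hy0, dist_left]
    refine le_dist_left_right fun w hw => ?_
    have := hvia w hw
    rw [zero_add, dist_comm (y 1), dist_comm (y 1), dist_comm (y 0) b, dist_comm w b]
    linarith
  obtain ⟨t, h0, h1, hl, hr, hcn⟩ :=
    (SegmentDouble.isCNSpace (y k) (y 0)).exists_isCNPoint_of_dist_add hd.symm
  have hzd : dist (z 0) (z k) = dist (f 0) (f k) := hz.closing
  have key : ∀ i ≤ k, dist (f i) (left _ _ (y 0)) ≤ dist (z i) (AffineMap.lineMap (z 0) (z k) t) :=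
    fun i hi => hcn.dist_le_dist_lineMap h0 h1 hzd (hz.diag i 0 hi (Nat.zero_le _))
      (hz.diag i k hi le_rfl)
  have hw0 : dist (AffineMap.lineMap (z 0) (z k) t : ℂ) (z 0) = dist (x 0) (x 1) := by
    rw [dist_lineMap_left, hzd, Real.norm_of_nonneg h0, ← hl, f1 0 (by omega), dist_left, dist_comm]
    exact h.side 0 (by omega)
  have hwk : dist (AffineMap.lineMap (z 0) (z k) t : ℂ) (z k) = dist (x 0) (x (k + 1)) := by
    rw [dist_lineMap_right, hzd, Real.norm_of_nonneg (by linarith), ← hr, f2,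
      dist_left_right_of_mem hy0, dist_comm, hb0, dist_comm]
  let w : ℕ → ℂ := fun i => if i = 0 then AffineMap.lineMap (z 0) (z k) t else z (i - 1)
  have w0 : w 0 = AffineMap.lineMap (z 0) (z k) t := if_pos rfl
  have ws : ∀ i, w (i + 1) = z i := fun i => if_neg (Nat.succ_ne_zero i)
  have diag0 : ∀ i ≤ k, dist (x (i + 1)) (x 0) ≤ dist (w (i + 1)) (w 0) := by
    intro i hi
    rw [ws, w0]
    refine le_trans ?_ (key i hi)
    rcases eq_or_lt_of_le hi with rfl | hi
    · rw [f2, dist_comm _ (left _ _ (y 0)), dist_left_right_of_mem hy0, dist_comm (y 0),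
        hb0]
    · rw [f1 i hi, dist_left]
      exact h.diag _ _ (by omega) (by omega)
  have diag1 : ∀ i j, i < j → j ≤ k → dist (x (i + 1)) (x (j + 1)) ≤ dist (z i) (z j) := by
    intro i j hij hj
    refine le_trans ?_ (hz.diag i j (by omega) hj)
    rw [f1 i (by omega)]
    rcases eq_or_lt_of_le hj with rfl | hj
    · rw [f2]
      exact h.dist_le_segmentDouble hX hb0 hbk (by omega)
    · rw [f1 j hj, dist_left]
      exact h.diag _ _ (by omega) (by omega)
  refine ⟨w, ⟨?_, ?_, ?_, ?_⟩⟩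
  · intro i hi
    rcases i with _ | i
    · rw [ws, w0, hw0]
    · rw [ws, ws, hz.side i (by omega), f1 i (by omega)]
      rcases eq_or_lt_of_le (by omega : i + 1 ≤ k) with hi | hi
      · rw [hi, f2, dist_left_right_of_mem hyk, dist_comm, hbk, dist_comm]
      · rw [f1 _ hi, dist_left]
        exact h.side _ hi
  · rw [ws, w0, hwk]
  · intro i j hi hj
    rcases i with _ | i <;> rcases j with _ | j
    · simp
    · rw [dist_comm, dist_comm (w 0)]
      exact diag0 j (by omega)
    · exact diag0 i (by omega)
    · rw [ws, ws]
      rcases lt_trichotomy i j with hij | rfl | hij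
      · exact diag1 i j hij (by omega)
      · simp
      · rw [dist_comm, dist_comm (z i)]
        exact diag1 j i hij (by omega)
  · refine cross_insert hz.cross ?_ ws
    rw [w0, segment_eq_image_lineMap]
    exact ⟨t, ⟨h0, h1⟩, rfl⟩

/-- The inductive step when the new triangle keeps the polygon convex. -/
theorem IsMajorant.extend (hX : IsCNSpace X) (h : IsMajorant k x y)
    (hb0 : dist b (y 0) = dist (x (k + 1)) (x 0)) (hbk : dist b (y k) = dist (x (k + 1)) (x k))
    (hmeet : ∀ j ≤ k, (segment ℝ b (y j) ∩ segment ℝ (y k) (y 0)).Nonempty) :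
    ∃ w, IsMajorant (k + 1) x w := by
  let w : ℕ → ℂ := fun i => if i ≤ k then y i else b
  have w1 : ∀ i ≤ k, w i = y i := fun i hi => if_pos hi
  have w2 : w (k + 1) = b := if_neg (by omega)
  -- The straight segment from `y i` to `b` meets the common side, so it is a competitor for the
  -- distance in the double.
  have diag1 : ∀ i ≤ k, dist (x i) (x (k + 1)) ≤ dist (y i) b := by
    intro i hi
    refine (h.dist_le_segmentDouble hX hb0 hbk hi).trans ?_
    obtain ⟨p, hp, hp'⟩ := hmeet i hi
    rw [← dist_add_dist_of_mem_segment (segment_symm ℝ b (y i) ▸ hp)]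
    exact dist_left_right_le _ _ hp'
  refine ⟨w, ⟨?_, ?_, ?_, ?_⟩⟩
  · intro i hi
    rcases eq_or_lt_of_le (by omega : i ≤ k) with rfl | hi
    · rw [w1 i le_rfl, w2, dist_comm, hbk, dist_comm]
    · rw [w1 i hi.le, w1 _ hi]
      exact h.side i hi
  · rw [w1 0 (Nat.zero_le _), w2, dist_comm, hb0, dist_comm]
  · intro i j hi hj
    rcases eq_or_lt_of_le hi with rfl | hi <;> rcases eq_or_lt_of_le hj with rfl | hj
    · simp
    · rw [w1 j (by omega), w2, dist_comm, dist_comm b]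
      exact diag1 j (by omega)
    · rw [w1 i (by omega), w2]
      exact diag1 i (by omega)
    · rw [w1 i (by omega), w1 j (by omega)]
      exact h.diag i j (by omega) (by omega)
  · intro i j m l hij hjm hml hl
    rw [w1 i (by omega), w1 j (by omega), w1 m (by omega)]
    rcases eq_or_lt_of_le hl with rfl | hl
    · rw [w2]
      -- The part of `[y j, b]` up to `r` is a cevian of the triangle `y j, y 0, y k`, and `[y i, y
      -- m]` meets both sides at `y j`.
      obtain ⟨r, hr, hr'⟩ := hmeet j (by omega)
      obtain ⟨p, hp, hp'⟩ : (segment ℝ (y j) (y 0) ∩ segment ℝ (y i) (y m)).Nonempty := by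
        rcases Nat.eq_zero_or_pos i with rfl | hi
        · exact ⟨y 0, right_mem_segment ℝ _ _, left_mem_segment ℝ _ _⟩
        · rw [segment_symm]
          exact h.cross 0 i j m hi hij hjm (by omega)
      obtain ⟨q, hq, hq'⟩ : (segment ℝ (y j) (y k) ∩ segment ℝ (y i) (y m)).Nonempty := by
        rcases eq_or_lt_of_le (by omega : m ≤ k) with rfl | hm
        · exact ⟨y m, right_mem_segment ℝ _ _, right_mem_segment ℝ _ _⟩
        · rw [Set.inter_comm]
          exact h.cross i j m k hij hjm hm le_rfl
      rw [segment_symm] at hr'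
      obtain ⟨c, hc, hc'⟩ := segment_inter_cevian_nonempty hp hq hr'
      refine ⟨c, (convex_segment _ _).segment_subset hp' hq' hc', ?_⟩
      rw [segment_symm] at hr
      exact (convex_segment _ _).segment_subset (left_mem_segment ℝ _ _) hr hc
    · rw [w1 l (by omega)]
      exact h.cross i j m l hij hjm hml (by omega)

theorem IsMajorant.reverse (h : IsMajorant k x y) :
    IsMajorant k (fun i => x (k - i)) (fun i => y (k - i)) := by
  refine ⟨fun i hi => ?_, ?_, fun i j hi hj => h.diag _ _ (by omega) (by omega), ?_⟩
  · have := h.side (k - (i + 1)) (by omega)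
    rw [show k - (i + 1) + 1 = k - i by omega] at this
    rw [dist_comm, this, dist_comm]
  · simpa [dist_comm] using h.closing
  · intro i j m l hij hjm hml hl
    have := h.cross (k - l) (k - m) (k - j) (k - i) (by omega) (by omega) (by omega) (by omega)
    rwa [segment_symm ℝ (y (k - l)), segment_symm ℝ (y (k - m)), Set.inter_comm] at this

/-- Reversal of the order of the first `k + 1` vertices. -/
def reverseInit {α : Type*} (k : ℕ) (x : ℕ → α) : ℕ → α := fun i => if i ≤ k then x (k - i) else x i

theorem reverseInit_of_le {α : Type*} (x : ℕ → α) {i : ℕ} (hi : i ≤ k) :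
    reverseInit k x i = x (k - i) := if_pos hi

theorem reverseInit_succ {α : Type*} (x : ℕ → α) : reverseInit k x (k + 1) = x (k + 1) :=
  if_neg (by omega)

/-- The cyclic polygon is only traversed backwards; the closing side and the side from `k` to `k +
1` change places. This reduces a reflex angle at `y k` to one at `y 0`. -/
theorem IsMajorant.reverseInit (h : IsMajorant (k + 1) (reverseInit k x) y) :
    IsMajorant (k + 1) x (reverseInit k y) := by
  have hx : ∀ i ≤ k, x i = _root_.reverseInit k x (k - i) := fun i hi => by
    rw [reverseInit_of_le _ (by omega), Nat.sub_sub_self hi]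
  refine ⟨?_, ?_, ?_, ?_⟩
  · intro i hi
    rw [reverseInit_of_le y (by omega), hx i (by omega)]
    rcases eq_or_lt_of_le (by omega : i ≤ k) with rfl | hi
    · rw [reverseInit_succ, Nat.sub_self, h.closing, reverseInit_succ]
    · rw [reverseInit_of_le y (by omega), hx (i + 1) (by omega)]
      have := h.side (k - (i + 1)) (by omega)
      rw [show k - (i + 1) + 1 = k - i by omega] at this
      rw [dist_comm, this, dist_comm]
  · rw [reverseInit_of_le y (Nat.zero_le _), reverseInit_succ, hx 0 (Nat.zero_le _), Nat.sub_zero,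
      h.side k (by omega), reverseInit_succ]
  · intro i j hi hj
    rcases eq_or_lt_of_le hi with rfl | hi <;> rcases eq_or_lt_of_le hj with rfl | hj
    · simp
    · rw [hx j (by omega), reverseInit_succ, reverseInit_of_le y (by omega), ← reverseInit_succ x]
      exact h.diag _ _ le_rfl (by omega)
    · rw [hx i (by omega), reverseInit_succ, reverseInit_of_le y (by omega), ← reverseInit_succ x]
      exact h.diag _ _ (by omega) le_rfl
    · rw [hx i (by omega), hx j (by omega), reverseInit_of_le y (by omega),
        reverseInit_of_le y (by omega)]
      exact h.diag _ _ (by omega) (by omega)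
  · intro i j m l hij hjm hml hl
    rw [reverseInit_of_le y (by omega), reverseInit_of_le y (by omega),
      reverseInit_of_le y (by omega)]
    rcases eq_or_lt_of_le hl with rfl | hl
    · rw [reverseInit_succ, segment_symm]
      exact h.cross _ _ _ _ (by omega) (by omega) (by omega) le_rfl
    · have := h.cross (k - l) (k - m) (k - j) (k - i) (by omega) (by omega) (by omega) (by omega)
      rwa [reverseInit_of_le y (by omega), segment_symm ℝ (y (k - i)), segment_symm ℝ (y (k - j)),
        Set.inter_comm]

end Step

/-! ### Position of the new triangle in the plane -/

theorem Isometry.image_segment_complex {φ : ℂ → ℂ} (hφ : Isometry φ) (a b : ℂ) :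
    φ '' segment ℝ a b = segment ℝ (φ a) (φ b) := by
  have := image_segment ℝ hφ.affineIsometryOfStrictConvexSpace.toAffineMap a b
  simpa using this

theorem IsMajorant.map_isometry {X : Type*} [PseudoMetricSpace X] {k : ℕ} {x : ℕ → X} {y : ℕ → ℂ}
    (h : IsMajorant k x y) {φ : ℂ → ℂ} (hφ : Isometry φ) : IsMajorant k x (fun i => φ (y i)) := by
  refine ⟨fun i hi => ?_, ?_, fun i j hi hj => ?_, fun i j m l hij hjm hml hl => ?_⟩
  · rw [hφ.dist_eq, h.side i hi]
  · rw [hφ.dist_eq, h.closing]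
  · rw [hφ.dist_eq]
    exact h.diag i j hi hj
  · rw [← hφ.image_segment_complex, ← hφ.image_segment_complex]
    exact ((h.cross i j m l hij hjm hml hl).image φ).mono (Set.image_inter_subset _ _ _)

theorem ofReal_mem_segment {a b c : ℝ} (hc : c ∈ Set.uIcc a b) :
    (c : ℂ) ∈ segment ℝ (a : ℂ) (b : ℂ) := by
  rw [← segment_eq_uIcc] at hc
  obtain ⟨s, t, hs, ht, hst, rfl⟩ := hc
  exact ⟨s, t, hs, ht, hst, by simp⟩

/-- The sum of the distances to `b` and `u` is convex and minimal at `q`, so on `[p, q]` it is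
largest at `p`. -/
theorem dist_add_dist_le_of_mem_segment {E : Type*} [SeminormedAddCommGroup E] [NormedSpace ℝ E]
    {b u a p q : E} (hq : q ∈ segment ℝ b u) (ha : a ∈ segment ℝ p q) :
    dist b a + dist a u ≤ dist b p + dist p u := by
  obtain ⟨s, t, hs, ht, hst, rfl⟩ := ha
  have h1 := (convexOn_univ_dist b).2 (Set.mem_univ p) (Set.mem_univ q) hs ht hst
  have h2 := (convexOn_univ_dist u).2 (Set.mem_univ p) (Set.mem_univ q) hs ht hst
  have h3 := dist_add_dist_of_mem_segment hq
  have h4 := dist_triangle b p u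
  rw [dist_comm b (s • p + t • q), dist_comm b p]
  rw [dist_comm b q] at h3
  rw [dist_comm b p] at h4
  simp only [smul_eq_mul] at h1 h2
  calc _ ≤ s * (dist p b + dist p u) + t * (dist q b + dist q u) := by linarith
    _ ≤ s * (dist p b + dist p u) + t * (dist p b + dist p u) := by
      have := mul_le_mul_of_nonneg_left
        (show dist q b + dist q u ≤ dist p b + dist p u by linarith) ht
      linarith
    _ = _ := by rw [← add_mul, hst, one_mul]

/-- The point where the segment from `b` to `u` crosses the real axis. -/
theorem exists_mem_segment_real {b u : ℂ} (h : 0 < u.im - b.im) (hb : b.im ≤ 0) (hu : 0 ≤ u.im) :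
    (((u.im * b.re - b.im * u.re) / (u.im - b.im) : ℝ) : ℂ) ∈ segment ℝ b u := by
  refine ⟨u.im / (u.im - b.im), -b.im / (u.im - b.im), by positivity,
    div_nonneg (by linarith) h.le, by field_simp; ring, ?_⟩
  apply Complex.ext
  · simp only [Complex.add_re, Complex.smul_re, Complex.ofReal_re, smul_eq_mul]
    field_simp
    ring
  · simp only [Complex.add_im, Complex.smul_im, Complex.ofReal_im, smul_eq_mul]
    field_simp
    ring

theorem exists_complex_dist_eq {L α β : ℝ} (hL : 0 ≤ L) (hα : 0 ≤ α) (hβ : 0 ≤ β) (h1 : L ≤ α + β)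
    (h2 : α ≤ L + β) (h3 : β ≤ L + α) : ∃ b : ℂ, b.im ≤ 0 ∧ dist b 0 = α ∧ dist b L = β := by
  rcases eq_or_lt_of_le hL with rfl | hL
  · obtain rfl : α = β := by linarith
    exact ⟨⟨0, -α⟩, by simpa using hα, by
      rw [dist_zero_right, Complex.norm_eq_sqrt_sq_add_sq]; simp [Real.sqrt_sq hα], by
      rw [Complex.ofReal_zero, dist_zero_right, Complex.norm_eq_sqrt_sq_add_sq]
      simp [Real.sqrt_sq hα]⟩
  -- The foot of the altitude, by the law of cosines.
  · set c := (α ^ 2 + L ^ 2 - β ^ 2) / (2 * L) with hc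
    have hcL : 2 * L * c = α ^ 2 + L ^ 2 - β ^ 2 := by rw [hc]; field_simp
    have hcα : c ≤ α := by
      rw [hc, div_le_iff₀ (by positivity)]; nlinarith
    have hcα' : -α ≤ c := by
      rw [hc, le_div_iff₀ (by positivity)]; nlinarith
    have hs : 0 ≤ α ^ 2 - c ^ 2 := by nlinarith
    refine ⟨⟨c, -Real.sqrt (α ^ 2 - c ^ 2)⟩, by simp [Real.sqrt_nonneg], ?_, ?_⟩
    · rw [dist_zero_right, Complex.norm_eq_sqrt_sq_add_sq]
      simp only [neg_sq, Real.sq_sqrt hs]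
      rw [add_sub_cancel, Real.sqrt_sq hα]
    · rw [dist_eq_norm, Complex.norm_eq_sqrt_sq_add_sq]
      simp only [Complex.sub_re, Complex.sub_im, Complex.ofReal_re, Complex.ofReal_im, sub_zero,
        neg_sq, Real.sq_sqrt hs]
      rw [show (c - L) ^ 2 + (α ^ 2 - c ^ 2) = β ^ 2 by linarith, Real.sqrt_sq hβ]

section Planar

variable {X : Type*} [PseudoMetricSpace X] {k : ℕ} {x : ℕ → X} {y : ℕ → ℂ} {b : ℂ} {L : ℝ}

/-- Either the shortest path from `b` to `y 1` through the segment `[y k, y 0]` turns at `y 0`, or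
no segment from `b` to a vertex passes the real axis on the far side of `y 0 = L`. -/
theorem IsMajorant.reflex_or_left (h : IsMajorant k x y) (hk : 1 ≤ k) (hL : 0 < L) (h0 : y 0 = L)
    (hyk : y k = 0) (him : ∀ j ≤ k, 0 ≤ (y j).im) (hb : b.im ≤ 0) :
    (∀ w ∈ segment ℝ (y k) (y 0), dist b (y 0) + dist (y 0) (y 1) ≤ dist b w + dist w (y 1)) ∨
    ∀ j ≤ k, 0 ≤ (L - b.re) * (y j).im + b.im * ((y j).re - L) ∧
      ¬ (b.im = 0 ∧ (y j).im = 0 ∧ L < b.re ∧ L < (y j).re) := by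
  -- If `[b, y 1]` meets the axis at `r ≥ L`, then `y 0` lies between every `w` of the side and `r`.
  by_cases hq : ∃ r : ℝ, L ≤ r ∧ (r : ℂ) ∈ segment ℝ b (y 1)
  · obtain ⟨r, hLr, hr⟩ := hq
    refine Or.inl fun w hw => dist_add_dist_le_of_mem_segment hr ?_
    obtain ⟨s, t, hs, ht, hst, rfl⟩ := hw
    have : s • y k + t • y 0 = ((t * L : ℝ) : ℂ) := by simp [hyk, h0]
    rw [this, h0]
    refine ofReal_mem_segment ?_
    rw [Set.mem_uIcc]
    exact Or.inl ⟨by nlinarith, hLr⟩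
  · right
    have hv2 := him 1 hk
    have hv : ¬ ((y 1).im = 0 ∧ L ≤ (y 1).re) := by
      rintro ⟨h1, h2⟩
      refine hq ⟨_, h2, ?_⟩
      rw [show (((y 1).re : ℝ) : ℂ) = y 1 from Complex.ext (by simp) (by simp [h1])]
      exact right_mem_segment ℝ _ _
    -- This expression, affine in the vertex, is nonnegative exactly when the crossing point of
    -- `exists_mem_segment_real` is at most `L`.
    have hR : 0 ≤ (L - b.re) * (y 1).im + b.im * ((y 1).re - L) := by
      by_contra! hneg
      have hpos : 0 < (y 1).im - b.im := by
        by_contra! hle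
        have e1 : (y 1).im = 0 := by linarith
        have e2 : b.im = 0 := by linarith
        simp [e1, e2] at hneg
      refine hq ⟨_, ?_, exists_mem_segment_real hpos hb hv2⟩
      rw [le_div_iff₀ hpos]
      linarith
    intro j hj
    rcases Nat.eq_zero_or_pos j with rfl | hj0
    · rw [h0]; simp
    rcases eq_or_lt_of_le hj with rfl | hjk
    · rw [hyk]
      refine ⟨?_, fun h => ?_⟩
      · simp only [Complex.zero_im, Complex.zero_re]
        nlinarith
      · have := h.2.2.2
        simp at this
        linarith
    rcases eq_or_lt_of_le (by omega : 1 ≤ j) with rfl | hj1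
    · exact ⟨hR, fun h => hv ⟨h.2.1, h.2.2.2.le⟩⟩
    -- The affine expression vanishes at `y 0` and is nonnegative at `y 1` and `y k`. Evaluated
    -- where `[y 0, y j]` crosses `[y 1, y k]`, it is nonnegative at `y j` too, unless the crossing
    -- is `y 0` itself (`s = 0`).
    obtain ⟨q, ⟨s', s, hs', hs, hss, e1⟩, ⟨a, a', ha, ha', haa, e2⟩⟩ :=
      h.cross 0 1 j k (by omega) hj1 hjk le_rfl
    rw [← e2, h0, hyk] at e1
    have ere := congrArg Complex.re e1
    have eim := congrArg Complex.im e1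
    simp at ere eim
    obtain rfl : s' = 1 - s := by linarith
    have hu := him j hj
    rcases eq_or_lt_of_le hs with rfl | hs
    · exfalso
      have ha0 : 0 < a := by
        rcases eq_or_lt_of_le ha with rfl | ha
        · simp at ere; linarith
        · exact ha
      refine hv ⟨?_, ?_⟩
      · have : a * (y 1).im = 0 := by linarith
        exact (mul_eq_zero.1 this).resolve_left ha0.ne'
      · have : 0 < (y 1).re := by
          by_contra! hneg
          nlinarith
        nlinarith
    · refine ⟨?_, ?_⟩
      · refine nonneg_of_mul_nonneg_right (a := s) ?_ hs
        have : s * ((L - b.re) * (y j).im + b.im * ((y j).re - L)) =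
            a * ((L - b.re) * (y 1).im + b.im * ((y 1).re - L)) + -b.im * L * a' := by
          obtain rfl : a' = 1 - a := by linarith
          linear_combination (L - b.re) * eim + b.im * ere
        rw [this]
        have : 0 ≤ -b.im * L * a' := mul_nonneg (mul_nonneg (by linarith) hL.le) ha'
        have := mul_nonneg ha hR
        linarith
      · rintro ⟨hb0, hu0, hbL, huL⟩
        rw [hb0] at hR
        have hv0 : (y 1).im = 0 := by nlinarith
        have hL' : L ≤ a * (y 1).re := by nlinarith
        refine hv ⟨hv0, ?_⟩
        have : 0 < (y 1).re := by
          by_contra! hneg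
          nlinarith
        nlinarith

/-- `h1` and `h2` place the crossing with the axis in `[0, L]`; `h1'` and `h2'` replace them when
`b` and `u` are both on the axis. -/
theorem segment_inter_nonempty_of_left {u : ℂ} (hL : 0 ≤ L) (hb : b.im ≤ 0) (hu : 0 ≤ u.im)
    (h1 : 0 ≤ (L - b.re) * u.im + b.im * (u.re - L))
    (h1' : ¬ (b.im = 0 ∧ u.im = 0 ∧ L < b.re ∧ L < u.re))
    (h2 : 0 ≤ b.re * u.im - b.im * u.re)
    (h2' : ¬ (b.im = 0 ∧ u.im = 0 ∧ b.re < 0 ∧ u.re < 0)) :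
    (segment ℝ b u ∩ segment ℝ (0 : ℂ) (L : ℂ)).Nonempty := by
  suffices ∃ r : ℝ, (r : ℂ) ∈ segment ℝ b u ∧ 0 ≤ r ∧ r ≤ L by
    obtain ⟨r, hr, hr0, hrL⟩ := this
    refine ⟨r, hr, ?_⟩
    have := ofReal_mem_segment (Set.mem_uIcc.2 (Or.inl ⟨hr0, hrL⟩))
    rwa [Complex.ofReal_zero] at this
  rcases lt_or_ge 0 (u.im - b.im) with h | h
  · refine ⟨_, exists_mem_segment_real h hb hu, div_nonneg (by linarith) h.le, ?_⟩
    rw [div_le_iff₀ h]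
    linarith
  · have e1 : u.im = 0 := by linarith
    have e2 : b.im = 0 := by linarith
    have hb' : ((b.re : ℝ) : ℂ) = b := Complex.ext (by simp) (by simp [e2])
    have hu' : ((u.re : ℝ) : ℂ) = u := Complex.ext (by simp) (by simp [e1])
    simp only [e1, e2, true_and, not_and, not_lt] at h1' h2'
    rw [← hb', ← hu']
    rcases lt_or_ge L b.re with h3 | h3
    · exact ⟨L, ofReal_mem_segment (Set.mem_uIcc.2 (Or.inr ⟨h1' h3, h3.le⟩)), hL, le_rfl⟩
    rcases lt_or_ge b.re 0 with h4 | h4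
    · exact ⟨0, ofReal_mem_segment (Set.mem_uIcc.2 (Or.inl ⟨h4.le, h2' h4⟩)), le_rfl, hL⟩
    · exact ⟨b.re, left_mem_segment ℝ _ _, h4, h3⟩

theorem isometry_sub_conj (L : ℂ) : Isometry fun u : ℂ => L - (starRingEnd ℂ) u := by
  refine Isometry.of_dist_eq fun u v => ?_
  rw [dist_sub_left, Complex.dist_conj_conj]

/-- Reflection in the line `Re = L / 2`, with reversed order, exchanges `y 0` and `y k`;
`IsMajorant.reflex_or_left` is applied at both ends. -/
theorem IsMajorant.reflex_or_meet (h : IsMajorant k x y) (hk : 1 ≤ k) (hL : 0 < L) (h0 : y 0 = L)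
    (hyk : y k = 0) (him : ∀ j ≤ k, 0 ≤ (y j).im) (hb : b.im ≤ 0) :
    (∀ w ∈ segment ℝ (y k) (y 0), dist b (y 0) + dist (y 0) (y 1) ≤ dist b w + dist w (y 1)) ∨
    (∀ w ∈ segment ℝ (y k) (y 0),
      dist b (y k) + dist (y k) (y (k - 1)) ≤ dist b w + dist w (y (k - 1))) ∨
    ∀ j ≤ k, (segment ℝ b (y j) ∩ segment ℝ (y k) (y 0)).Nonempty := by
  refine (h.reflex_or_left hk hL h0 hyk him hb).imp_right fun hl => ?_
  have hφ := isometry_sub_conj L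
  set φ : ℂ → ℂ := fun u => L - (starRingEnd ℂ) u with hφd
  have him' : ∀ u, (φ u).im = u.im := fun u => by simp [hφd]
  have hre' : ∀ u, (φ u).re = L - u.re := fun u => by simp [hφd]
  refine ((h.reverse.map_isometry hφ).reflex_or_left (b := φ b) hk hL (by simp [hyk, hφd])
    (by simp [h0, hφd]) (fun j hj => ?_) (by rwa [him'])).imp (fun hr => ?_) fun hr => ?_
  · rw [him']
    exact him _ (by omega)
  · intro w hw
    have := hr (φ w) (by
      rw [← hφ.image_segment_complex, Nat.sub_self, Nat.sub_zero, segment_symm]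
      exact Set.mem_image_of_mem _ hw)
    simpa only [hφ.dist_eq, Nat.sub_zero] using this
  · intro j hj
    obtain ⟨h1, h1'⟩ := hl j hj
    obtain ⟨h2, h2'⟩ := hr (k - j) (by omega)
    simp only [Nat.sub_sub_self hj, him', hre'] at h2 h2'
    rw [h0, hyk]
    refine segment_inter_nonempty_of_left hL.le hb (him j hj) h1 h1' (by linarith) fun h3 => ?_
    exact h2' ⟨h3.1, h3.2.1, by linarith [h3.2.2.1], by linarith [h3.2.2.2]⟩

/-- A majorant can be placed with its closing side on the real axis and on one side of it. -/
theorem IsMajorant.exists_normalized (h : IsMajorant k x y) (hne : y 0 ≠ y k) :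
    ∃ (z : ℕ → ℂ) (L : ℝ), 0 < L ∧ IsMajorant k x z ∧ z 0 = L ∧ z k = 0 ∧
      ∀ j ≤ k, 0 ≤ (z j).im := by
  have hne' : y 0 - y k ≠ 0 := sub_ne_zero.2 hne
  set L := ‖y 0 - y k‖ with hL
  have hL0 : 0 < L := norm_pos_iff.2 hne'
  set c : ℂ := L / (y 0 - y k) with hc
  have hcn : ‖c‖ = 1 := by
    rw [hc, norm_div, Complex.norm_real, Real.norm_of_nonneg hL0.le, ← hL, div_self hL0.ne']
  have hφ : Isometry fun u : ℂ => (u - y k) * c := by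
    refine Isometry.of_dist_eq fun u v => ?_
    rw [dist_eq_norm, ← sub_mul, norm_mul, hcn, mul_one, dist_eq_norm]
    congr 1
    ring
  obtain ⟨z, hz, hz0, hzk⟩ : ∃ z : ℕ → ℂ, IsMajorant k x z ∧ z 0 = L ∧ z k = 0 :=
    ⟨_, h.map_isometry hφ, by rw [hc]; field_simp, by simp⟩
  -- Where `[z 0, z j]` crosses `[z i, z k]`, the imaginary part is a nonnegative multiple of both
  -- `(z i).im` and `(z j).im`. Opposite signs would force `s = a = 0`, hence `L = 0`.
  have hsame : ∀ i j, 0 < i → i < j → j < k → 0 ≤ (z i).im * (z j).im := by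
    intro i j hi hij hj
    obtain ⟨q, ⟨s', s, hs', hs, hss, e1⟩, ⟨a, a', ha, ha', haa, e2⟩⟩ := hz.cross 0 i j k hi hij hj le_rfl
    rw [← e2, hz0, hzk] at e1
    have ere := congrArg Complex.re e1
    have eim := congrArg Complex.im e1
    simp at ere eim
    by_contra! hneg
    have h1 : s * (z i).im * (z j).im = a * (z i).im ^ 2 := by linear_combination (z i).im * eim
    have h2 : 0 < (z i).im ^ 2 := by
      rw [sq_pos_iff]
      rintro h
      simp [h] at hneg
    have hs0 : s = 0 := by nlinarith
    have ha0 : a = 0 := by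
      rw [hs0] at h1
      have : a * (z i).im ^ 2 = 0 := by linarith
      exact (mul_eq_zero.1 this).resolve_right h2.ne'
    rw [hs0, ha0] at ere
    obtain rfl : s' = 1 := by linarith
    linarith
  have hsame' : ∀ i j, i ≤ k → j ≤ k → 0 ≤ (z i).im * (z j).im := by
    have h0 : (z 0).im = 0 := by rw [hz0]; simp
    have hk0 : (z k).im = 0 := by rw [hzk]; simp
    intro i j hi hj
    rcases Nat.eq_zero_or_pos i with rfl | hi0
    · simp [h0]
    rcases Nat.eq_zero_or_pos j with rfl | hj0
    · simp [h0]
    rcases eq_or_lt_of_le hi with rfl | hi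
    · simp [hk0]
    rcases eq_or_lt_of_le hj with rfl | hj
    · simp [hk0]
    rcases lt_trichotomy i j with hij | rfl | hij
    · exact hsame i j hi0 hij hj
    · exact mul_self_nonneg _
    · rw [mul_comm]
      exact hsame j i hj0 hij hi
  by_cases hall : ∀ j ≤ k, 0 ≤ (z j).im
  · exact ⟨z, L, hL0, hz, hz0, hzk, hall⟩
  · push Not at hall
    obtain ⟨i, hi, hneg⟩ := hall
    refine ⟨_, L, hL0, hz.map_isometry Complex.isometry_conj, by simp [hz0], by simp [hzk], ?_⟩
    intro j hj
    have := hsame' i j hi hj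
    rw [Complex.conj_im]
    nlinarith

end Planar

/-! ### Induction on the number of vertices -/

/-- The inductive step of the construction of planar majorants. -/
theorem IsCNSpace.exists_isMajorant_succ {X : Type*} [PseudoMetricSpace X] (hX : IsCNSpace X)
    {k : ℕ} (hk : 1 ≤ k)
    (hQ : ∀ (p q : ℂ) (x : ℕ → SegmentDouble p q), ∃ y, IsMajorant k x y) (x : ℕ → X)
    (hx : ∃ y, IsMajorant k x y) : ∃ y, IsMajorant (k + 1) x y := by
  obtain ⟨y, hy⟩ := hx
  have t1 := dist_triangle_left (x 0) (x k) (x (k + 1))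
  have t2 := dist_triangle (x (k + 1)) (x 0) (x k)
  have t3 := dist_triangle_right (x (k + 1)) (x 0) (x k)
  by_cases hne : y 0 = y k
  -- The closing side is a point, so any `b` at the right distance will do and every path through
  -- that side turns at `y 0`.
  · have hd := hy.closing
    rw [hne, dist_self] at hd
    have hb0 : dist (y 0 + (dist (x (k + 1)) (x 0) : ℝ)) (y 0) = dist (x (k + 1)) (x 0) := by
      rw [dist_eq_norm, add_sub_cancel_left, Complex.norm_real, Real.norm_of_nonneg dist_nonneg]
    refine hy.exists_of_reflex hX hk hQ hb0 ?_ ?_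
    · rw [← hne, hb0]
      linarith
    · rw [← hne, segment_same]
      rintro w rfl
      exact le_rfl
  · obtain ⟨z, L, hL, hz, hz0, hzk, him⟩ := hy.exists_normalized hne
    have hLd : L = dist (x 0) (x k) := by
      rw [← hz.closing, hz0, hzk, dist_zero_right, Complex.norm_real, Real.norm_of_nonneg hL.le]
    obtain ⟨b, hb, hbk, hb0⟩ := exists_complex_dist_eq (α := dist (x (k + 1)) (x k))
      (β := dist (x (k + 1)) (x 0)) hL.le dist_nonneg dist_nonneg (by linarith) (by linarith)
      (by linarith)
    rw [← hzk] at hbk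
    rw [← hz0] at hb0
    rcases hz.reflex_or_meet hk hL hz0 hzk him hb with h | h | h
    · exact hz.exists_of_reflex hX hk hQ hb0 hbk h
    · have hrev : IsMajorant k (reverseInit k x) (fun i => z (k - i)) := by
        have := hz.reverse
        refine ⟨fun i hi => ?_, ?_, fun i j hi hj => ?_, this.cross⟩
        · rw [this.side i hi, reverseInit_of_le _ (by omega), reverseInit_of_le _ (by omega)]
        · rw [this.closing, reverseInit_of_le _ (by omega), reverseInit_of_le _ (by omega)]
        · rw [reverseInit_of_le _ hi, reverseInit_of_le _ hj]
          exact this.diag i j hi hj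
      obtain ⟨w, hw⟩ := hrev.exists_of_reflex hX hk hQ (b := b)
        (by rw [reverseInit_succ, reverseInit_of_le _ (by omega)]; exact hbk)
        (by rw [reverseInit_succ, reverseInit_of_le _ le_rfl, Nat.sub_self]; exact hb0)
        (by rw [Nat.sub_self, Nat.sub_zero, segment_symm]; exact h)
      exact ⟨_, hw.reverseInit⟩
    · exact hz.extend hX hb0 hbk h

theorem exists_isMajorant_one {X : Type*} [PseudoMetricSpace X] (x : ℕ → X) :
    ∃ y, IsMajorant 1 x y := by
  have key : ∀ i j : ℕ, i ≤ 1 → j ≤ 1 →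
      dist (((i * dist (x 0) (x 1) : ℝ)) : ℂ) ((j * dist (x 0) (x 1) : ℝ) : ℂ) =
        dist (x i) (x j) := by
    intro i j hi hj
    interval_cases i <;> interval_cases j <;> simp [dist_comm]
  refine ⟨fun i => ((i * dist (x 0) (x 1) : ℝ) : ℂ), fun i hi => key _ _ (by omega) (by omega),
    key _ _ (by omega) (by omega), fun i j hi hj => (key i j hi hj).ge, ?_⟩
  intro i j m l hij hjm hml hl
  omega

/-- Closed polygons in spaces satisfying the Bruhat–Tits inequality have planar majorants. -/
theorem IsCNSpace.exists_isMajorant {X : Type*} [PseudoMetricSpace X] (hX : IsCNSpace X) {k : ℕ}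
    (hk : 1 ≤ k) (x : ℕ → X) : ∃ y, IsMajorant k x y := by
  -- Doubles of the plane come first, for all `p, q` at once, since each step glues along a new
  -- segment. The step for any space, doubles included, uses only doubles of the plane.
  have hQ : ∀ k : ℕ, 1 ≤ k → ∀ (p q : ℂ) (x : ℕ → SegmentDouble p q), ∃ y, IsMajorant k x y := by
    intro k hk
    induction k, hk using Nat.le_induction with
    | base => exact fun p q x => exists_isMajorant_one x
    | succ k hk ih =>
      exact fun p q x => (SegmentDouble.isCNSpace p q).exists_isMajorant_succ hk ih x (ih p q x)
  induction k, hk using Nat.le_induction with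
  | base => exact exists_isMajorant_one x
  | succ k hk ih => exact hX.exists_isMajorant_succ hk (hQ k hk) x ih

/-! ### CAT(0) spaces and the point condition -/

section Geodesic

variable {X : Type*} [MetricSpace X] {x y z u : X} {S : Set X}

/-- Length is additive, and each of the two parts is at least as long as the distance between its
ends. -/
theorem IsGeodesicSegment.dist_add_dist (h : IsGeodesicSegment S x y) (hu : u ∈ S) :
    dist x u + dist u y = dist x y := by
  obtain ⟨L, γ, hL, -, rfl, rfl, hvar, rfl⟩ := h
  obtain ⟨s, ⟨h0, h1⟩, rfl⟩ := hu
  refine le_antisymm ?_ (dist_triangle _ _ _)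
  have hadd := eVariationOn.Icc_add_Icc γ (s := Set.univ) h0 h1 (Set.mem_univ s)
  simp only [Set.univ_inter] at hadd
  have e1 := eVariationOn.edist_le γ (Set.left_mem_Icc.2 h0) (Set.right_mem_Icc.2 h0)
  have e2 := eVariationOn.edist_le γ (Set.left_mem_Icc.2 h1) (Set.right_mem_Icc.2 h1)
  have := add_le_add e1 e2
  rw [hadd, hvar, edist_dist, edist_dist, ← ENNReal.ofReal_add dist_nonneg dist_nonneg] at this
  exact (ENNReal.ofReal_le_ofReal_iff dist_nonneg).1 this

theorem IsGeodesicSegment.left_mem (h : IsGeodesicSegment S x y) : x ∈ S := by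
  obtain ⟨L, γ, hL, -, rfl, -, -, rfl⟩ := h
  exact ⟨0, Set.left_mem_Icc.2 hL, rfl⟩

theorem IsGeodesicSegment.exists_dist_eq (h : IsGeodesicSegment S x y) {t : ℝ} (h0 : 0 ≤ t)
    (h1 : t ≤ 1) : ∃ m ∈ S, dist x m = t * dist x y ∧ dist m y = (1 - t) * dist x y := by
  obtain ⟨m, hm, hd⟩ : ∃ m ∈ S, dist x m = t * dist x y := by
    obtain ⟨L, γ, hL, hc, h0', hL', -, rfl⟩ := h
    have := intermediate_value_Icc hL (f := fun s => dist x (γ s)) (by fun_prop)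
    obtain ⟨s, hs, e⟩ := this (show t * dist x y ∈ Set.Icc (dist x (γ 0)) (dist x (γ L)) by
      rw [h0', hL', dist_self]
      exact ⟨by positivity, mul_le_of_le_one_left dist_nonneg h1⟩)
    exact ⟨γ s, Set.mem_image_of_mem _ hs, e⟩
  refine ⟨m, hm, hd, ?_⟩
  have := h.dist_add_dist hm
  linarith

theorem exists_comparisonTriangle (x y z : X) :
    ∃ x' y' z' : EuclPlane, IsComparisonTriangle x y z x' y' z' := by
  obtain ⟨b, -, h1, h2⟩ := exists_complex_dist_eq (L := dist x y) (α := dist z x) (β := dist y z)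
    dist_nonneg dist_nonneg dist_nonneg
    (by have := dist_triangle_left x y z; rw [dist_comm z y] at this; exact this)
    (by have := dist_triangle_right z x y; rw [dist_comm z y] at this; linarith)
    (by have := dist_triangle_left y z x; rw [dist_comm x z] at this; exact this)
  let e := Complex.orthonormalBasisOneI.repr
  refine ⟨e 0, e (dist x y : ℝ), e b, ?_, ?_, ?_⟩
  · rw [e.dist_map, dist_comm, dist_zero_right, Complex.norm_real, Real.norm_of_nonneg dist_nonneg]
  · rw [e.dist_map, dist_comm, h2]
  · rw [e.dist_map, h1]

/-- The CAT(0) comparison with `v = z`, a vertex of the triangle, combined with Stewart's theorem.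
-/
theorem IsCAT0.isCNSpace (h : IsCAT0 X) : IsCNSpace X := by
  intro x y t h0 h1
  obtain ⟨S, hS⟩ := h.1 x y
  obtain ⟨m, hm, hl, hr⟩ := hS.exists_dist_eq h0 h1
  refine ⟨m, fun z => ?_⟩
  obtain ⟨x', y', z', hc⟩ := exists_comparisonTriangle x y z
  obtain ⟨Syz, hyz⟩ := h.1 y z
  obtain ⟨Szx, hzx⟩ := h.1 z x
  have hle := h.2 x y z S Syz Szx ⟨hS, hyz, hzx⟩ x' y' z' hc m hm z hzx.left_mem
    (AffineMap.lineMap x' y' t) z'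
    ⟨by rw [segment_eq_image_lineMap]; exact ⟨t, ⟨h0, h1⟩, rfl⟩, by
      rw [dist_left_lineMap, Real.norm_of_nonneg h0, hc.dist_xy, hl]⟩
    ⟨right_mem_segment ℝ _ _, by rw [dist_comm, hc.dist_zx, dist_comm]⟩
  rw [dist_comm m z, dist_comm _ z'] at hle
  have := pow_le_pow_left₀ dist_nonneg hle 2
  rwa [dist_lineMap_sq, hc.dist_zx, hc.dist_xy, dist_comm z' y', hc.dist_yz, dist_comm y z] at this

theorem IsCAT0.pointCondition (h : IsCAT0 X) {n : ℕ} (hn : 2 ≤ n) : PointCondition X n := by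
  intro x hx
  obtain ⟨k, rfl⟩ : ∃ k, n = k + 1 := ⟨n - 1, by omega⟩
  obtain ⟨y, hy⟩ := h.isCNSpace.exists_isMajorant (k := k) (by omega) (fun i => x (i + 1))
  let e := Complex.orthonormalBasisOneI.repr
  let x' : ℕ → EuclPlane := fun i => if i = 0 then e (y k) else e (y (i - 1))
  have hs : ∀ i, x' (i + 1) = e (y i) := fun i => if_neg (Nat.succ_ne_zero i)
  have h0 : x' 0 = e (y k) := if_pos rfl
  have hdiag : ∀ i j, 1 ≤ i → i ≤ k + 1 → 1 ≤ j → j ≤ k + 1 →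
      dist (x i) (x j) ≤ dist (x' i) (x' j) := by
    intro i j hi hi' hj hj'
    obtain ⟨i, rfl⟩ := Nat.exists_eq_succ_of_ne_zero (by omega : i ≠ 0)
    obtain ⟨j, rfl⟩ := Nat.exists_eq_succ_of_ne_zero (by omega : j ≠ 0)
    rw [Nat.succ_eq_add_one, Nat.succ_eq_add_one, hs, hs, e.dist_map]
    exact hy.diag i j (by omega) (by omega)
  refine ⟨x', hx, by rw [h0, hs], fun i hi hi' => ?_, fun i hi hi' => hdiag _ _ (by omega)
    (by omega) (by omega) hi', fun i j hi hi' hj hj' => ?_⟩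
  · obtain ⟨i, rfl⟩ := Nat.exists_eq_succ_of_ne_zero (by omega : i ≠ 0)
    rw [Nat.succ_eq_add_one, Nat.add_sub_cancel, hs]
    rcases i with _ | i
    · rw [h0, e.dist_map, hy.closing, hx]
    · rw [hs, e.dist_map, dist_comm (y (i + 1)), hy.side i (by omega), dist_comm]
  · rw [add_zero]
    exact hdiag i j (by omega) hi' (by omega) hj'

/-- A quadrilateral with one vertex on the geodesic between its neighbours is thinner than the
Euclidean triangle. -/
theorem PointCondition.isCNPoint {n : ℕ} (h : PointCondition X n) (hn : 4 ≤ n) {m : X} {t : ℝ}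
    (h0 : 0 ≤ t) (h1 : t ≤ 1) (hl : dist x m = t * dist x y)
    (hr : dist m y = (1 - t) * dist x y) : IsCNPoint x y m t := by
  intro z
  -- The vertex `z` fills index `0` and all indices from `4` on; the sides of length zero make its
  -- images coincide.
  let p : ℕ → X := fun i => if i = 1 then x else if i = 2 then m else if i = 3 then y else z
  have hpn : ∀ i, 4 ≤ i → p i = z := fun i hi => by
    simp [p, show i ≠ 1 by omega, show i ≠ 2 by omega, show i ≠ 3 by omega]
  obtain ⟨q, hq⟩ := h p (by rw [hpn n hn]; rfl)
  have s1 : dist x z = dist (q 1) (q 0) := hq.dist_side 1 le_rfl (by omega)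
  have s2 : dist m x = dist (q 2) (q 1) := hq.dist_side 2 (by omega) (by omega)
  have s3 : dist y m = dist (q 3) (q 2) := hq.dist_side 3 (by omega) (by omega)
  have s4 : dist z y = dist (q 4) (q 3) := by
    have := hq.dist_side 4 (by omega) hn
    rwa [hpn 4 le_rfl] at this
  have d13 : dist x y ≤ dist (q 1) (q 3) := hq.dist_first 3 (by omega) (by omega)
  have hconst : ∀ i, 4 ≤ i → i ≤ n → q i = q 4 := by
    intro i hi
    induction i, hi using Nat.le_induction with
    | base => exact fun _ => rfl
    | succ i hi ih =>
      intro hin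
      have := hq.dist_side (i + 1) (by omega) hin
      rw [Nat.add_sub_cancel, hpn _ (by omega), hpn _ hi, dist_self] at this
      rw [← ih (by omega)]
      exact dist_eq_zero.1 this.symm
  have hq0 : q 0 = q 4 := hq.closed'.trans (hconst n hn le_rfl)
  rw [hq0] at s1
  have d24 : dist m z ≤ dist (q 2) (q 4) := by
    have := hq.dist_diag 2 4 le_rfl (by omega) (by omega) hn
    rw [hpn 4 le_rfl, add_zero] at this
    exact this
  -- With `d13` this gives equality, so `q 2` lies on the segment from `q 1` to `q 3`.
  have tri := dist_triangle (q 1) (q 2) (q 3)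
  rw [dist_comm (q 1) (q 2), ← s2, dist_comm (q 2) (q 3), ← s3, dist_comm m x, dist_comm y m] at tri
  have e13 : dist (q 1) (q 3) = dist x y := by linarith
  have hst := isCNSpace_innerProductSpace.isCNPoint_of_dist_eq (x := q 1) (y := q 3) (m := q 2)
    h0 h1 (by rw [dist_comm, ← s2, dist_comm, hl, e13])
    (by rw [dist_comm, ← s3, dist_comm, hr, e13]) (q 4)
  rw [dist_comm (q 4) (q 1), ← s1, ← s4, e13, dist_comm x z] at hst
  rw [dist_comm m z, dist_comm (q 2)] at d24
  exact (pow_le_pow_left₀ dist_nonneg d24 2).trans hst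

/-- The inequality is used twice: for `z` against `u` on `[x, y]`, then for `u` against `v` on `[x,
z]`, where the first bound controls `d(u, z)`. -/
theorem isCAT0_of_isCNPoint (hX : IsGeodesicSpace X)
    (h : ∀ (x y m : X) (t : ℝ), 0 ≤ t → t ≤ 1 → dist x m = t * dist x y →
      dist m y = (1 - t) * dist x y → IsCNPoint x y m t) : IsCAT0 X := by
  refine ⟨hX, ?_⟩
  intro x y z Sxy Syz Szx hT x' y' z' hc u hu v hv u' v' hu' hv'
  obtain ⟨hus, hud⟩ := hu'
  obtain ⟨hvs, hvd⟩ := hv'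
  rw [segment_eq_image_lineMap] at hus hvs
  obtain ⟨s, ⟨hs0, hs1⟩, rfl⟩ := hus
  obtain ⟨t, ⟨ht0, ht1⟩, rfl⟩ := hvs
  have hdu := hT.side_xy.dist_add_dist hu
  have hdv := hT.side_zx.dist_add_dist hv
  rw [add_comm, dist_comm v, dist_comm z v, dist_comm z x] at hdv
  have hzx : dist x' z' = dist x z := by rw [dist_comm, hc.dist_zx, dist_comm]
  have hs : dist x u = s * dist x y := by
    rw [← hud, dist_left_lineMap, Real.norm_of_nonneg hs0, hc.dist_xy]
  have ht : dist x v = t * dist x z := by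
    rw [← hvd, dist_left_lineMap, Real.norm_of_nonneg ht0, hzx]
  have h1 := h x y u s hs0 hs1 hs (by linarith)
  have h2 : dist z u ≤ dist z' (AffineMap.lineMap x' y' s) :=
    h1.dist_le_dist_lineMap hs0 hs1 hc.dist_xy hc.dist_zx.ge
      (by rw [dist_comm z y, dist_comm z' y', hc.dist_yz])
  exact (h x z v t ht0 ht1 ht (by linarith)).dist_le_dist_lineMap ht0 ht1 hzx
    (by rw [dist_comm u x, dist_comm _ x', hud]) (by rwa [dist_comm u z, dist_comm _ z'])

end Geodesic

theorem theoremT {X : Type*} [MetricSpace X] [CompleteSpace X] (hX : IsGeodesicSpace X)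
    (n : ℕ) (hn : 4 ≤ n) : PointCondition X n ↔ IsCAT0 X :=
  ⟨fun h => isCAT0_of_isCNPoint hX fun _ _ _ _ h0 h1 hl hr => h.isCNPoint hn h0 h1 hl hr,
    fun h => h.pointCondition (by omega)⟩
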